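/- Let $\mathcal U,\mathcal X_+,\mathcal X_-$ be complex Hilbert spaces; all operators are bounded and linear, "invertible" means boundedly invertible, and an operator is called exponentially stable if its spectrum is contained in the open unit disc $\mathbb D$. Let $R$ be a $\mathcal B(\mathcal U)$-valued function which is analytic with invertible values on an open neighborhood of the unit circle $\mathbb T$, given near $\mathbb T$ by a stable representation $$R(z)=\delta+z\gamma_+(I-z\alpha_+)^{-1}\beta_+ +\gamma_-(zI-\alpha_-)^{-1}\beta_-,$$ where $\delta\in\mathcal B(\mathcal U)$, $\alpha_\pm\in\mathcal B(\mathcal X_\pm)$, $\beta_\pm\in\mathcal B(\mathcal U,\mathcal X_\pm)$, $\gamma_\pm\in\mathcal B(\mathcal X_\pm,\mathcal U)$ and $\alpha_+,\alpha_-$ are exponentially stable. A factorization $R(z)=W_+(z)W_-(z)$, valid near $\mathbb T$, with $\mathcal B(\mathcal U)$-valued functions $W_\pm$ is called a left canonical Wiener–Hopf factorization if $W_+$ is analytic and invertible on $\overline{\mathbb D}$ with inverse analytic on $\overline{\mathbb D}$, and $W_-$ is analytic and invertible on $(\mathbb C\setminus\mathbb D)\cup\{\infty\}$ with inverse analytic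 there. An operator $\widetilde Q\in\mathcal B(\mathcal X_-,\mathcal X_+)$ is called a stabilizing solution if $\delta-\gamma_+\widetilde Q\beta_-$ is invertible, $$\widetilde Q=\alpha_+\widetilde Q\alpha_-+(\beta_+-\alpha_+\widetilde Q\beta_-)(\delta-\gamma_+\widetilde Q\beta_-)^{-1}(\gamma_--\gamma_+\widetilde Q\alpha_-),$$ and the operators $$\widetilde\alpha_-^\circ:=\alpha_--\beta_-(\delta-\gamma_+\widetilde Q\beta_-)^{-1}(\gamma_--\gamma_+\widetilde Q\alpha_-),\qquad \widetilde\alpha_+^\circ:=\alpha_+-(\beta_+-\alpha_+\widetilde Q\beta_-)(\delta-\gamma_+\widetilde Q\beta_-)^{-1}\gamma_+$$ are exponentially stable. Then: (1) $R$ admits a left canonical Wiener–Hopf factorization if and only if there exists a stabilizing solution $\widetilde Q\in\mathcal B(\mathcal X_-,\mathcal X_+)$. (2) There is at most one stabilizing solution. (3) Let $\widetilde Q$ be a stabilizing solution and let $\widetilde\delta_+,\widetilde\delta_-\in\mathcal B(\mathcal U)$ be any invertible operators with $\widetilde\delta_+\widetilde\delta_-=\delta-\gamma_+\widetilde Q\beta_-$.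 Put $$\widetilde\gamma_-^\circ:=\widetilde\delta_+^{-1}(\gamma_--\gamma_+\widetilde Q\alpha_-),\qquad \widetilde\beta_+^\circ:=(\beta_+-\alpha_+\widetilde Q\beta_-)\widetilde\delta_-^{-1}.$$ Then $$W_+(z)=\widetilde\delta_++z\gamma_+(I-z\alpha_+)^{-1}\widetilde\beta_+^\circ,\qquad W_-(z)=\widetilde\delta_-+\widetilde\gamma_-^\circ(zI-\alpha_-)^{-1}\beta_-$$ give a left canonical Wiener–Hopf factorization $R(z)=W_+(z)W_-(z)$, and $$W_+(z)^{-1}=\widetilde\delta_+^{-1}-z\widetilde\delta_+^{-1}\gamma_+(I-z\widetilde\alpha_+^\circ)^{-1}\widetilde\beta_+^\circ\widetilde\delta_+^{-1}\quad(|z|\le1),$$ $$W_-(z)^{-1}=\widetilde\delta_-^{-1}-\widetilde\delta_-^{-1}\widetilde\gamma_-^\circ(zI-\widetilde\alpha_-^\circ)^{-1}\beta_-\widetilde\delta_-^{-1}\quad(|z|\ge1).$$ -/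

import Mathlib

open scoped Topology

namespace WienerHopf

section Factorization

variable {U : Type*} [NormedAddCommGroup U] [InnerProductSpace ℂ U]

/-- `W` is analytic and invertible on the closed unit disc, with analytic inverse.
(`AnalyticOnNhd` on a closed set means analyticity on an open neighbourhood of it.) -/
structure IsInteriorFactor (W : ℂ → U →L[ℂ] U) : Prop where
  analytic : AnalyticOnNhd ℂ W {z | ‖z‖ ≤ 1}
  isUnit : ∀ z : ℂ, ‖z‖ ≤ 1 → IsUnit (W z)
  analytic_inv : AnalyticOnNhd ℂ (fun z => Ring.inverse (W z)) {z | ‖z‖ ≤ 1}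

/-- `W` is analytic and invertible on the exterior `{1 ≤ |z|} ∪ {∞}` of the open unit disc, with
analytic inverse. Analyticity at `∞` with value `W∞` is analyticity at `0` of `z ↦ W (1 / z)`,
given the value `W∞` at `z = 0`. -/
structure IsExteriorFactor (W : ℂ → U →L[ℂ] U) : Prop where
  analytic : AnalyticOnNhd ℂ W {z | 1 ≤ ‖z‖}
  isUnit : ∀ z : ℂ, 1 ≤ ‖z‖ → IsUnit (W z)
  analytic_inv : AnalyticOnNhd ℂ (fun z => Ring.inverse (W z)) {z | 1 ≤ ‖z‖}
  at_infinity : ∃ Winf : U →L[ℂ] U, IsUnit Winf ∧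
    AnalyticAt ℂ (Function.update (fun z : ℂ => W z⁻¹) 0 Winf) 0 ∧
    AnalyticAt ℂ (Function.update (fun z : ℂ => Ring.inverse (W z⁻¹)) 0 (Ring.inverse Winf)) 0

/-- `R = W₊ W₋` (on a neighbourhood of the unit circle) is a left canonical Wiener-Hopf
factorization. -/
structure IsLeftCanonicalFactorization (R Wp Wm : ℂ → U →L[ℂ] U) : Prop where
  interior : IsInteriorFactor Wp
  exterior : IsExteriorFactor Wm
  factor : ∀ᶠ z in 𝓝ˢ (Metric.sphere (0 : ℂ) 1), R z = Wp z ∘L Wm z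

/-- `R` admits a left canonical Wiener-Hopf factorization. -/
def AdmitsLeftCanonicalFactorization (R : ℂ → U →L[ℂ] U) : Prop :=
  ∃ Wp Wm : ℂ → U →L[ℂ] U, IsLeftCanonicalFactorization R Wp Wm

/-- The spectrum lies in the open unit disc. -/
def ExponentiallyStable (α : U →L[ℂ] U) : Prop :=
  spectrum ℂ α ⊆ Metric.ball (0 : ℂ) 1

end Factorization

/-- The operators of a stable representation
`δ + z γ₊ (I - z α₊)⁻¹ β₊ + γ₋ (z I - α₋)⁻¹ β₋`. -/
structure StableData (U Xp Xm : Type*)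
    [NormedAddCommGroup U] [InnerProductSpace ℂ U]
    [NormedAddCommGroup Xp] [InnerProductSpace ℂ Xp]
    [NormedAddCommGroup Xm] [InnerProductSpace ℂ Xm] where
  δ : U →L[ℂ] U
  αp : Xp →L[ℂ] Xp
  βp : U →L[ℂ] Xp
  γp : Xp →L[ℂ] U
  αm : Xm →L[ℂ] Xm
  βm : U →L[ℂ] Xm
  γm : Xm →L[ℂ] U
  stable_p : ExponentiallyStable αp
  stable_m : ExponentiallyStable αm

namespace StableData

variable {U Xp Xm : Type*}
  [NormedAddCommGroup U] [InnerProductSpace ℂ U]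
  [NormedAddCommGroup Xp] [InnerProductSpace ℂ Xp]
  [NormedAddCommGroup Xm] [InnerProductSpace ℂ Xm]

/-- The function `δ + z γ₊ (I - z α₊)⁻¹ β₊ + γ₋ (z I - α₋)⁻¹ β₋`. -/
noncomputable def eval (S : StableData U Xp Xm) (z : ℂ) : U →L[ℂ] U :=
  S.δ + z • (S.γp ∘L Ring.inverse (1 - z • S.αp) ∘L S.βp)
    + S.γm ∘L Ring.inverse (z • 1 - S.αm) ∘L S.βm

/-- The data `S` give a stable representation of `R` near the unit circle. -/
def Represents (S : StableData U Xp Xm) (R : ℂ → U →L[ℂ] U) : Prop :=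
  ∀ᶠ z in 𝓝ˢ (Metric.sphere (0 : ℂ) 1), R z = S.eval z

/-- `δ - γ₊ Q β₋`. -/
def pivot (S : StableData U Xp Xm) (Q : Xm →L[ℂ] Xp) : U →L[ℂ] U :=
  S.δ - S.γp ∘L Q ∘L S.βm

/-- `β₊ - α₊ Q β₋`. -/
def colOp (S : StableData U Xp Xm) (Q : Xm →L[ℂ] Xp) : U →L[ℂ] Xp :=
  S.βp - S.αp ∘L Q ∘L S.βm

/-- `γ₋ - γ₊ Q α₋`. -/
def rowOp (S : StableData U Xp Xm) (Q : Xm →L[ℂ] Xp) : Xm →L[ℂ] U :=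
  S.γm - S.γp ∘L Q ∘L S.αm

/-- `α₋° = α₋ - β₋ (δ - γ₊ Q β₋)⁻¹ (γ₋ - γ₊ Q α₋)`. -/
noncomputable def αmCirc (S : StableData U Xp Xm) (Q : Xm →L[ℂ] Xp) : Xm →L[ℂ] Xm :=
  S.αm - S.βm ∘L Ring.inverse (S.pivot Q) ∘L S.rowOp Q

/-- `α₊° = α₊ - (β₊ - α₊ Q β₋) (δ - γ₊ Q β₋)⁻¹ γ₊`. -/
noncomputable def αpCirc (S : StableData U Xp Xm) (Q : Xm →L[ℂ] Xp) : Xp →L[ℂ] Xp :=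
  S.αp - S.colOp Q ∘L Ring.inverse (S.pivot Q) ∘L S.γp

/-- `Q` is a stabilizing solution of the Riccati equation
`Q = α₊ Q α₋ + (β₊ - α₊ Q β₋) (δ - γ₊ Q β₋)⁻¹ (γ₋ - γ₊ Q α₋)`. -/
structure IsStabilizingSolution (S : StableData U Xp Xm) (Q : Xm →L[ℂ] Xp) : Prop where
  isUnit_pivot : IsUnit (S.pivot Q)
  riccati : Q = S.αp ∘L Q ∘L S.αm + S.colOp Q ∘L Ring.inverse (S.pivot Q) ∘L S.rowOp Q
  stable_m : ExponentiallyStable (S.αmCirc Q)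
  stable_p : ExponentiallyStable (S.αpCirc Q)

/-- `γ₋° = δ₊⁻¹ (γ₋ - γ₊ Q α₋)`. -/
noncomputable def γmCirc (S : StableData U Xp Xm) (Q : Xm →L[ℂ] Xp) (δp : U →L[ℂ] U) :
    Xm →L[ℂ] U :=
  Ring.inverse δp ∘L S.rowOp Q

/-- `β₊° = (β₊ - α₊ Q β₋) δ₋⁻¹`. -/
noncomputable def βpCirc (S : StableData U Xp Xm) (Q : Xm →L[ℂ] Xp) (δm : U →L[ℂ] U) :
    U →L[ℂ] Xp :=
  S.colOp Q ∘L Ring.inverse δm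

/-- `W₊(z) = δ₊ + z γ₊ (I - z α₊)⁻¹ β₊°`. -/
noncomputable def Wp (S : StableData U Xp Xm) (Q : Xm →L[ℂ] Xp) (δp δm : U →L[ℂ] U) (z : ℂ) :
    U →L[ℂ] U :=
  δp + z • (S.γp ∘L Ring.inverse (1 - z • S.αp) ∘L S.βpCirc Q δm)

/-- `W₋(z) = δ₋ + γ₋° (z I - α₋)⁻¹ β₋`. -/
noncomputable def Wm (S : StableData U Xp Xm) (Q : Xm →L[ℂ] Xp) (δp δm : U →L[ℂ] U) (z : ℂ) :
    U →L[ℂ] U :=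
  δm + S.γmCirc Q δp ∘L Ring.inverse (z • 1 - S.αm) ∘L S.βm

/-- The formula `δ₊⁻¹ - z δ₊⁻¹ γ₊ (I - z α₊°)⁻¹ β₊° δ₊⁻¹`. -/
noncomputable def WpInv (S : StableData U Xp Xm) (Q : Xm →L[ℂ] Xp) (δp δm : U →L[ℂ] U) (z : ℂ) :
    U →L[ℂ] U :=
  Ring.inverse δp - z • (Ring.inverse δp ∘L S.γp ∘L Ring.inverse (1 - z • S.αpCirc Q) ∘L
    S.βpCirc Q δm ∘L Ring.inverse δp)

/-- The formula `δ₋⁻¹ - δ₋⁻¹ γ₋° (z I - α₋°)⁻¹ β₋ δ₋⁻¹`. -/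
noncomputable def WmInv (S : StableData U Xp Xm) (Q : Xm →L[ℂ] Xp) (δp δm : U →L[ℂ] U) (z : ℂ) :
    U →L[ℂ] U :=
  Ring.inverse δm - Ring.inverse δm ∘L S.γmCirc Q δp ∘L Ring.inverse (z • 1 - S.αmCirc Q) ∘L
    S.βm ∘L Ring.inverse δm

end StableData

end WienerHopf

/-!
Write `w = 1 / z`, so that functions analytic on the closed unit disc and functions analytic on its
exterior including `∞` both become analytic functions on the closed disc, in `z` and in `w`. Two
analytic tools carry the proof.

* Liouville (`eq_of_eq_on_circle`): if `f z = g w` for `|z| = 1` with `f`, `g` analytic on the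
  closed disc, then both are the same constant.
* Division with remainder (`exists_remainder`): for stable `α`, an operator function `V` analytic
  on the closed disc is `V w = b + (w - α) m w` with `b` constant and `m` analytic there, and
  similarly with `w - α` on the right.

From these, the Stein equation `Q - α₊ Q α₋ = K` with stable coefficients is uniquely solvable
(`exists_stein`, `eq_zero_of_stein`). Its solution splits
`(1 - z α₊)⁻¹ K (1 - w α₋)⁻¹` into an interior and an exterior part
(`inverse_comp_stein_comp_inverse`).

*From a solution to a factorization.* Put `b = β₊°`, `c = γ₋°`. The Riccati equation reads
`Q - α₊ Q α₋ = b c`, and splitting the product `W₊ W₋` gives `R` (`Wp_comp_Wm`). The inverses of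
`W₊` and `W₋` come from Schur complements (`isUnit_and_inverse_realization`), whose invertibility
is the stability of `α₊°` and `α₋°`.

*From a factorization to a solution* (`exists_isStabilizingSolution`). Let `R = P N` on the circle,
with `P` a function of `z` and `N` of `w`. Take the remainder `b` of `β₊ N⁻¹` on left division by
`w - α₊` and the remainder `c` of `P⁻¹ γ₋` on right division by `z - α₋`, and let
`Q - α₊ Q α₋ = b c`. Comparing interior and exterior parts, by Liouville, in `R N⁻¹ = P`,
`P⁻¹ R = N`, `β₊ N⁻¹ N = β₊` and `P P⁻¹ γ₋ = γ₋` shows that `P` and `N` have the realizations of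
`W₊` and `W₋` with `b = β₊°`, `c = γ₋°`, `P 0 N 0 = δ - γ₊ Q β₋`. No observability or
controllability is needed. Reading the Schur complements backwards gives stability.

*Uniqueness* (`IsStabilizingSolution.unique`). The difference of two solutions satisfies the
homogeneous Stein equation `X = α₊° X α₋°` with stable coefficients, so it vanishes.
-/

namespace WienerHopf

/-! ### Analytic operator functions on the closed disc -/

section Analytic

variable {E F G : Type*} [NormedAddCommGroup E] [NormedSpace ℂ E]
  [NormedAddCommGroup F] [NormedSpace ℂ F] [NormedAddCommGroup G] [NormedSpace ℂ G]

lemma analyticAt_clm_comp {f : ℂ → F →L[ℂ] G} {g : ℂ → E →L[ℂ] F} {z : ℂ}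
    (hf : AnalyticAt ℂ f z) (hg : AnalyticAt ℂ g z) :
    AnalyticAt ℂ (fun w => f w ∘L g w) z :=
  ((ContinuousLinearMap.compL ℂ E F G).analyticAt_bilinear (f z, g z)).comp₂ hf hg

lemma analyticAt_ringInverse [CompleteSpace E] {f : ℂ → E →L[ℂ] E} {z : ℂ}
    (hf : AnalyticAt ℂ f z) (h : IsUnit (f z)) :
    AnalyticAt ℂ (fun w => Ring.inverse (f w)) z := by
  obtain ⟨u, hu⟩ := h
  have h1 : AnalyticAt ℂ (Ring.inverse : (E →L[ℂ] E) → E →L[ℂ] E) (f z) := by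
    rw [← hu]
    exact (contDiffAt_ringInverse (n := ⊤) ℂ u).analyticAt
  exact h1.comp hf

/-- An analytic function on the closed unit disc which agrees on the unit circle with `H (1 / z)`,
where `H` is also analytic on the closed unit disc, is constant: the two functions glue to a
bounded entire function. -/
lemma eq_of_eq_on_circle {f H : ℂ → E} (hF : AnalyticOnNhd ℂ f {z | ‖z‖ ≤ 1})
    (hH : AnalyticOnNhd ℂ H {z | ‖z‖ ≤ 1}) (h : ∀ z w : ℂ, ‖z‖ = 1 → z * w = 1 → f z = H w)
    {z : ℂ} (hz : ‖z‖ ≤ 1) : f z = H 0 := by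
  classical
  set K : ℂ → E := fun z => if ‖z‖ ≤ 1 then f z else H z⁻¹ with hK
  have hHinv : ∀ z : ℂ, 1 ≤ ‖z‖ → AnalyticAt ℂ (fun z => H z⁻¹) z := by
    intro z hz
    have hz0 : z ≠ 0 := by rintro rfl; norm_num at hz
    have : AnalyticAt ℂ H z⁻¹ := hH _ (by simpa using inv_le_one_of_one_le₀ hz)
    exact this.comp (f := fun z : ℂ => z⁻¹) (analyticAt_id.inv hz0)
  have hdiff : Differentiable ℂ K := by
    intro z
    rcases lt_trichotomy ‖z‖ 1 with hlt | heq | hgt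
    · have : K =ᶠ[𝓝 z] f := by
        filter_upwards [continuous_norm.continuousAt.eventually_lt_const hlt] with w hw
        simp [hK, hw.le]
      exact ((hF z hlt.le).congr this.symm).differentiableAt
    · have hfreq : ∃ᶠ w in 𝓝[≠] z, f w = H w⁻¹ := by
        -- every point of the unit circle is an accumulation point of it
        have hz0 : z ≠ 0 := by rintro rfl; norm_num at heq
        have hpath : Filter.Tendsto (fun t : ℝ => z * Complex.exp (t * Complex.I)) (𝓝[≠] 0)
            (𝓝[≠] z) := by
          refine tendsto_nhdsWithin_iff.2 ⟨?_, ?_⟩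
          · have : Continuous fun t : ℝ => z * Complex.exp (t * Complex.I) := by fun_prop
            simpa using (this.tendsto 0).mono_left nhdsWithin_le_nhds
          · have hm : Set.Ioo (-1 : ℝ) 1 ∈ 𝓝 (0 : ℝ) := Ioo_mem_nhds (by norm_num) (by norm_num)
            filter_upwards [self_mem_nhdsWithin, mem_nhdsWithin_of_mem_nhds hm] with t ht ht1 hcon
            have h1 : Complex.exp (t * Complex.I) = 1 := by
              have : z * Complex.exp (t * Complex.I) = z * 1 := by simpa using hcon
              exact mul_left_cancel₀ hz0 this
            obtain ⟨n, hn⟩ := Complex.exp_eq_one_iff.1 h1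
            have h2 : (t : ℂ) = n * (2 * Real.pi) := by
              have : (t : ℂ) * Complex.I = (n * (2 * Real.pi)) * Complex.I := by
                rw [hn]; ring
              exact mul_right_cancel₀ Complex.I_ne_zero this
            have h3 : t = n * (2 * Real.pi) := by exact_mod_cast h2
            have hpi := Real.pi_gt_three
            have hn0 : n ≠ 0 := by
              rintro rfl
              exact ht (by simpa using h3)
            have habs : |t| < 1 := abs_lt.2 ht1
            rw [h3, abs_mul, abs_of_pos (by positivity : (0 : ℝ) < 2 * Real.pi)] at habs
            have : (1 : ℝ) ≤ |(n : ℝ)| := by exact_mod_cast Int.one_le_abs hn0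
            nlinarith
        refine hpath.frequently (Filter.Eventually.frequently ?_)
        refine Filter.Eventually.of_forall fun t => ?_
        have hn : ‖z * Complex.exp (t * Complex.I)‖ = 1 := by
          rw [norm_mul, heq, Complex.norm_exp_ofReal_mul_I, one_mul]
        exact h _ _ hn (mul_inv_cancel₀ (by intro h0; rw [h0] at hn; norm_num at hn))
      have hev : f =ᶠ[𝓝 z] fun w => H w⁻¹ :=
        ((hF z heq.le).frequently_eq_iff_eventually_eq (hHinv z heq.ge)).1 hfreq
      have : K =ᶠ[𝓝 z] f := by
        filter_upwards [hev] with w hw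
        by_cases h1 : ‖w‖ ≤ 1
        · simp [hK, h1]
        · simp [hK, h1, hw]
      exact ((hF z heq.le).congr this.symm).differentiableAt
    · have : K =ᶠ[𝓝 z] fun z => H z⁻¹ := by
        filter_upwards [continuous_norm.continuousAt.eventually_const_lt hgt] with w hw
        simp [hK, not_le.2 hw]
      exact ((hHinv z hgt.le).congr this.symm).differentiableAt
  have hcomp : IsCompact {z : ℂ | ‖z‖ ≤ 1} := by
    have : {z : ℂ | ‖z‖ ≤ 1} = Metric.closedBall 0 1 := by ext; simp
    rw [this]; exact isCompact_closedBall 0 1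
  have hbdd : Bornology.IsBounded (Set.range K) := by
    have hb1 := (hcomp.image_of_continuousOn hF.continuousOn).isBounded
    have hb2 := (hcomp.image_of_continuousOn hH.continuousOn).isBounded
    refine (hb1.union hb2).subset ?_
    rintro _ ⟨w, rfl⟩
    by_cases h1 : ‖w‖ ≤ 1
    · exact Or.inl ⟨w, h1, by simp [hK, h1]⟩
    · exact Or.inr ⟨w⁻¹, by simpa using inv_le_one_of_one_le₀ (not_le.1 h1).le, by simp [hK, h1]⟩
  have hconst : ∀ w, K w = f z := by
    intro w
    have := hdiff.apply_eq_apply_of_bounded hbdd w z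
    rw [this]; simp [hK, hz]
  -- the constant value is recovered at infinity
  have hlim : Filter.Tendsto H (𝓝[≠] 0) (𝓝 (H 0)) :=
    ((hH 0 (by simp)).continuousAt.tendsto).mono_left nhdsWithin_le_nhds
  have hlim' : Filter.Tendsto H (𝓝[≠] 0) (𝓝 (f z)) := by
    refine tendsto_const_nhds.congr' ?_
    have hb : Metric.ball (0 : ℂ) 1 ∈ 𝓝 (0 : ℂ) := Metric.ball_mem_nhds _ one_pos
    filter_upwards [self_mem_nhdsWithin, mem_nhdsWithin_of_mem_nhds hb] with w hw hw1
    have h1 : ¬ ‖w⁻¹‖ ≤ 1 := by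
      rw [norm_inv, not_le]
      exact (one_lt_inv₀ (norm_pos_iff.2 hw)).2 (by simpa using hw1)
    rw [← hconst w⁻¹]
    simp only [hK, h1, if_false, inv_inv]
  exact tendsto_nhds_unique hlim' hlim

lemma clm_circleIntegral [CompleteSpace E] [CompleteSpace F] (L : E →L[ℂ] F) {g : ℂ → E}
    {c : ℂ} {r : ℝ} (hg : CircleIntegrable g c r) :
    L (∮ ζ in C(c, r), g ζ) = ∮ ζ in C(c, r), L (g ζ) := by
  unfold circleIntegral
  rw [← L.intervalIntegral_comp_comm hg.out]
  simp

/-- Division with remainder by the operator pencil `z - L`, whose resolvent set contains the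
exterior of the closed unit disc: the quotient is the Cauchy integral of `(ζ - L)⁻¹ V ζ` over a
slightly larger circle, and the remainder is a constant. -/
lemma exists_remainder [CompleteSpace E] (L : E →L[ℂ] E) {V : ℂ → E}
    (hV : AnalyticOnNhd ℂ V {z | ‖z‖ ≤ 1}) (ρ : ℂ → E →L[ℂ] E)
    (hρ : ∀ ζ : ℂ, 1 < ‖ζ‖ → ContinuousAt ρ ζ)
    (hρL : ∀ ζ : ℂ, 1 < ‖ζ‖ → ∀ x, ζ • ρ ζ x - L (ρ ζ x) = x) :
    ∃ (b : E) (m : ℂ → E), AnalyticOnNhd ℂ m {z | ‖z‖ ≤ 1} ∧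
      ∀ w : ℂ, ‖w‖ ≤ 1 → V w = b + (w • m w - L (m w)) := by
  obtain ⟨r, hr1, hVr⟩ : ∃ r : ℝ, 1 < r ∧ ∀ z : ℂ, ‖z‖ ≤ r → AnalyticAt ℂ V z := by
    have hsub : Metric.closedBall (0 : ℂ) 1 ⊆ {z | AnalyticAt ℂ V z} :=
      fun z hz => hV z (by simpa using hz)
    obtain ⟨ε, hε, h⟩ := (isCompact_closedBall (0 : ℂ) 1).exists_cthickening_subset_open
      (isOpen_analyticAt ℂ V) hsub
    rw [cthickening_closedBall hε.le zero_le_one] at h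
    exact ⟨ε + 1, by linarith, fun z hz => h (by simpa using hz)⟩
  have hr0 : 0 < r := by linarith
  lift r to NNReal using hr0.le
  set g : ℂ → E := fun ζ => ρ ζ (V ζ) with hg
  have hgc : ContinuousOn g (Metric.sphere 0 r) := by
    intro ζ hζ
    have hζ' : ‖ζ‖ = r := by simpa using hζ
    exact ((hρ ζ (by linarith)).clm_apply (hVr ζ hζ'.le).continuousAt).continuousWithinAt
  have hgi : CircleIntegrable g 0 r := hgc.circleIntegrable hr0.le
  set m : ℂ → E := fun w => (2 * Real.pi * Complex.I : ℂ)⁻¹ • ∮ ζ in C(0, r), (ζ - w)⁻¹ • g ζ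
    with hm
  refine ⟨(2 * Real.pi * Complex.I : ℂ)⁻¹ • ∮ ζ in C(0, r), g ζ, m, ?_, ?_⟩
  · intro w hw
    have hw' : ‖w‖ ≤ 1 := hw
    have := hasFPowerSeriesOn_cauchy_integral hgi hr0
    refine this.analyticOnNhd w ?_
    rw [mem_eball_zero_iff, enorm_lt_coe, ← NNReal.coe_lt_coe]
    simpa using lt_of_le_of_lt hw' hr1
  · intro w hw
    have hne : ∀ ζ ∈ Metric.sphere (0 : ℂ) r, ζ - w ≠ 0 := by
      intro ζ hζ h0
      have hζ' : ‖ζ‖ = r := by simpa using hζ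
      rw [sub_eq_zero.1 h0] at hζ'
      linarith
    have hinv : ContinuousOn (fun ζ : ℂ => (ζ - w)⁻¹) (Metric.sphere 0 r) :=
      ContinuousOn.inv₀ (by fun_prop) hne
    have hi1 : CircleIntegrable (fun ζ => (ζ - w)⁻¹ • g ζ) 0 r :=
      (hinv.smul hgc).circleIntegrable hr0.le
    have hVc : ContinuousOn V (Metric.closedBall 0 r) := fun ζ hζ =>
      (hVr ζ (by simpa using hζ)).continuousAt.continuousWithinAt
    have hi2 : CircleIntegrable (fun ζ => (ζ - w)⁻¹ • V ζ) 0 r :=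
      (hinv.smul (hVc.mono Metric.sphere_subset_closedBall)).circleIntegrable hr0.le
    have hcauchy : (2 * Real.pi * Complex.I : ℂ)⁻¹ • ∮ ζ in C(0, r), (ζ - w)⁻¹ • V ζ = V w := by
      have hd : DifferentiableOn ℂ V (Metric.closedBall 0 r) := fun ζ hζ =>
        (hVr ζ (by simpa using hζ)).differentiableAt.differentiableWithinAt
      have hw' : w ∈ Metric.ball (0 : ℂ) r := by simpa using lt_of_le_of_lt hw hr1
      rw [hd.circleIntegral_sub_inv_smul hw', smul_smul, inv_mul_cancel₀, one_smul]
      simp [Real.pi_ne_zero]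
    -- under the integral, `(w - L) (ζ - L)⁻¹ = 1 - (ζ - w) (ζ - L)⁻¹`
    have hcomb : w • m w - L (m w) =
        V w - (2 * Real.pi * Complex.I : ℂ)⁻¹ • ∮ ζ in C(0, r), g ζ := by
      rw [← hcauchy]
      simp only [hm]
      rw [map_smul, clm_circleIntegral L hi1, smul_comm w, ← circleIntegral.integral_smul,
        ← smul_sub, ← smul_sub, ← circleIntegral.integral_sub, ← circleIntegral.integral_sub hi2 hgi]
      · congr 1
        refine circleIntegral.integral_congr hr0.le fun ζ hζ => ?_
        have hζ' : ‖ζ‖ = r := by simpa using hζ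
        have h1 := hρL ζ (by linarith) (V ζ)
        have h2 : L (g ζ) = ζ • g ζ - V ζ := 
          eq_sub_of_add_eq' (sub_eq_iff_eq_add.1 h1).symm
        have h3 : g ζ = (ζ - w)⁻¹ • ((ζ - w) • g ζ) := by
          rw [smul_smul, inv_mul_cancel₀ (hne ζ hζ), one_smul]
        simp only [map_smul]
        rw [h2]
        conv_rhs => rw [h3]
        rw [smul_comm w, ← smul_sub, ← smul_sub, sub_smul]
        congr 1
        abel
      · exact (hinv.smul hgc).const_smul w |>.circleIntegrable hr0.le
      · exact ((L.continuous.comp_continuousOn (hinv.smul hgc))).circleIntegrable hr0.le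
    rw [hcomb]; abel

end Analytic

/-! ### Stable operators, the Stein equation and Schur complements -/

section Resolvent

variable {X Y : Type*} [NormedAddCommGroup X] [InnerProductSpace ℂ X]
  [NormedAddCommGroup Y] [InnerProductSpace ℂ Y]

lemma norm_eq_one_of_mul_eq_one {z w : ℂ} (hz : ‖z‖ = 1) (h : z * w = 1) : ‖w‖ = 1 := by
  have := congrArg norm h
  rwa [norm_mul, hz, one_mul, norm_one] at this

lemma inverse_comp_self {A : X →L[ℂ] X} (h : IsUnit A) : Ring.inverse A ∘L A = 1 :=
  Ring.inverse_mul_cancel A h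

lemma comp_inverse_self {A : X →L[ℂ] X} (h : IsUnit A) : A ∘L Ring.inverse A = 1 :=
  Ring.mul_inverse_cancel A h

/-- The resolvent in the coordinate at infinity. -/
lemma inverse_smul_one_sub (α : X →L[ℂ] X) {z w : ℂ} (h : z * w = 1) :
    Ring.inverse (z • 1 - α) = w • Ring.inverse (1 - w • α) := by
  have hz : z ≠ 0 := left_ne_zero_of_mul_eq_one h
  have h1 : z • (1 : X →L[ℂ] X) - α = (z • 1) * (1 - w • α) := by
    rw [smul_one_mul, smul_sub, smul_smul, h, one_smul]
  have h2 : (z • (1 : X →L[ℂ] X)) * (w • 1) = 1 := by rw [smul_one_mul, smul_smul, h, one_smul]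
  have h3 : (w • (1 : X →L[ℂ] X)) * (z • 1) = 1 := by
    rw [smul_one_mul, smul_smul, mul_comm, h, one_smul]
  let u : (X →L[ℂ] X)ˣ := ⟨z • 1, w • 1, h2, h3⟩
  have hu : Ring.inverse (z • (1 : X →L[ℂ] X)) = w • 1 := Ring.inverse_unit u
  rw [h1, Ring.inverse_mul (Or.inl u.isUnit), hu, mul_smul_one]

lemma exponentiallyStable_iff {α : X →L[ℂ] X} :
    ExponentiallyStable α ↔ ∀ z : ℂ, ‖z‖ ≤ 1 → IsUnit (1 - z • α) := by
  have key : ∀ z w : ℂ, z * w = 1 → (IsUnit (algebraMap ℂ (X →L[ℂ] X) z - α) ↔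
      IsUnit (1 - w • α)) := by
    intro z w h
    have h1 : algebraMap ℂ (X →L[ℂ] X) z - α = z • (1 - w • α) := by
      rw [smul_sub, smul_smul, h, one_smul, Algebra.algebraMap_eq_smul_one]
    rw [h1]
    exact isUnit_smul_iff (Units.mk0 z (left_ne_zero_of_mul_eq_one h)) _
  constructor
  · intro hs z hz
    rcases eq_or_ne z 0 with rfl | hz0
    · simp
    · rw [← key z⁻¹ z (inv_mul_cancel₀ hz0)]
      by_contra hcon
      have : z⁻¹ ∈ Metric.ball (0 : ℂ) 1 := hs (spectrum.mem_iff.2 hcon)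
      rw [mem_ball_zero_iff, norm_inv] at this
      exact absurd (one_le_inv₀ (norm_pos_iff.2 hz0) |>.2 hz) (not_le.2 this)
  · intro hu z hz
    rw [mem_ball_zero_iff]
    by_contra! hcon
    have hz0 : z ≠ 0 := by rintro rfl; norm_num at hcon
    exact spectrum.mem_iff.1 hz ((key z z⁻¹ (mul_inv_cancel₀ hz0)).2
      (hu z⁻¹ (by rw [norm_inv]; exact inv_le_one_of_one_le₀ hcon)))

lemma isUnit_smul_one_sub {α : X →L[ℂ] X} (hα : ExponentiallyStable α) {z : ℂ} (hz : 1 ≤ ‖z‖) :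
    IsUnit (z • 1 - α) := by
  rw [← Algebra.algebraMap_eq_smul_one]
  by_contra hcon
  have := hα (spectrum.mem_iff.2 hcon)
  rw [mem_ball_zero_iff] at this
  linarith

lemma analyticOnNhd_inverse_one_sub [CompleteSpace X] {α : X →L[ℂ] X}
    (hα : ExponentiallyStable α) :
    AnalyticOnNhd ℂ (fun z : ℂ => Ring.inverse (1 - z • α)) {z | ‖z‖ ≤ 1} := fun z hz =>
  analyticAt_ringInverse (by fun_prop) (exponentiallyStable_iff.1 hα z hz)

lemma continuousAt_inverse_smul_one_sub [CompleteSpace X] {α : X →L[ℂ] X}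
    (hα : ExponentiallyStable α) {z : ℂ} (hz : 1 ≤ ‖z‖) :
    ContinuousAt (fun z : ℂ => Ring.inverse (z • 1 - α)) z :=
  (analyticAt_ringInverse (by fun_prop) (isUnit_smul_one_sub hα hz)).continuousAt

/-- Left division of an operator function by `z - α`. -/
lemma exists_left_remainder [CompleteSpace X] [CompleteSpace Y] {α : Y →L[ℂ] Y}
    (hα : ExponentiallyStable α) {V : ℂ → X →L[ℂ] Y} (hV : AnalyticOnNhd ℂ V {z | ‖z‖ ≤ 1}) :
    ∃ (b : X →L[ℂ] Y) (m : ℂ → X →L[ℂ] Y), AnalyticOnNhd ℂ m {z | ‖z‖ ≤ 1} ∧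
      ∀ w : ℂ, ‖w‖ ≤ 1 → V w = b + (w • m w - α ∘L m w) := by
  refine exists_remainder (ContinuousLinearMap.compL ℂ X Y Y α) hV
    (fun ζ => ContinuousLinearMap.compL ℂ X Y Y (Ring.inverse (ζ • 1 - α)))
    (fun ζ hζ => (ContinuousLinearMap.continuous _).continuousAt.comp
      (continuousAt_inverse_smul_one_sub hα hζ.le)) fun ζ hζ x => ?_
  have h := congrArg (· ∘L x) (comp_inverse_self (isUnit_smul_one_sub hα hζ.le))
  simpa [ContinuousLinearMap.sub_comp, ContinuousLinearMap.comp_assoc,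
    ContinuousLinearMap.one_def] using h

/-- Right division of an operator function by `z - α`. -/
lemma exists_right_remainder [CompleteSpace X] [CompleteSpace Y] {α : X →L[ℂ] X}
    (hα : ExponentiallyStable α) {V : ℂ → X →L[ℂ] Y} (hV : AnalyticOnNhd ℂ V {z | ‖z‖ ≤ 1}) :
    ∃ (b : X →L[ℂ] Y) (m : ℂ → X →L[ℂ] Y), AnalyticOnNhd ℂ m {z | ‖z‖ ≤ 1} ∧
      ∀ w : ℂ, ‖w‖ ≤ 1 → V w = b + (w • m w - m w ∘L α) := by
  refine exists_remainder ((ContinuousLinearMap.compL ℂ X X Y).flip α) hV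
    (fun ζ => (ContinuousLinearMap.compL ℂ X X Y).flip (Ring.inverse (ζ • 1 - α)))
    (fun ζ hζ => (ContinuousLinearMap.continuous _).continuousAt.comp
      (continuousAt_inverse_smul_one_sub hα hζ.le)) fun ζ hζ x => ?_
  have h := congrArg (x ∘L ·) (inverse_comp_self (isUnit_smul_one_sub hα hζ.le))
  simpa [ContinuousLinearMap.comp_sub, ContinuousLinearMap.comp_assoc,
    ContinuousLinearMap.one_def] using h

lemma smul_comp_one_sub (T : X →L[ℂ] Y) (β : X →L[ℂ] X) {z w : ℂ} (h : z * w = 1) :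
    z • (T ∘L (1 - w • β)) = z • T - T ∘L β := by
  simp only [ContinuousLinearMap.comp_sub, ContinuousLinearMap.comp_smul, smul_sub, smul_smul, h,
    ContinuousLinearMap.one_def, ContinuousLinearMap.comp_id, one_smul]

/-- Partial fractions on the unit circle, where `w = 1 / z`. -/
lemma inverse_comp_stein_comp_inverse {α : Y →L[ℂ] Y} {β : X →L[ℂ] X} {z w : ℂ} (h : z * w = 1)
    (hα : IsUnit (1 - z • α)) (hβ : IsUnit (1 - w • β)) (Q : X →L[ℂ] Y) :
    Ring.inverse (1 - z • α) ∘L (Q - α ∘L Q ∘L β) ∘L Ring.inverse (1 - w • β) =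
      Q ∘L Ring.inverse (1 - w • β) + z • (Ring.inverse (1 - z • α) ∘L α ∘L Q) := by
  have h1 : Q - α ∘L Q ∘L β = (1 - z • α) ∘L Q + z • (α ∘L Q ∘L (1 - w • β)) := by
    simp only [ContinuousLinearMap.sub_comp, ContinuousLinearMap.comp_sub, smul_sub,
      ContinuousLinearMap.comp_smul, ContinuousLinearMap.smul_comp, smul_smul, h,
      ContinuousLinearMap.one_def, ContinuousLinearMap.comp_id, ContinuousLinearMap.id_comp]
    module
  rw [h1]
  simp only [ContinuousLinearMap.add_comp, ContinuousLinearMap.comp_add,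
    ContinuousLinearMap.comp_smul, ContinuousLinearMap.smul_comp, ContinuousLinearMap.comp_assoc,
    comp_inverse_self hβ]
  rw [← ContinuousLinearMap.comp_assoc _ (1 - z • α), inverse_comp_self hα]
  simp only [ContinuousLinearMap.one_def, ContinuousLinearMap.comp_id,
    ContinuousLinearMap.id_comp]

lemma inverse_one_sub_smul_eq {α : X →L[ℂ] X} {z : ℂ} (h : IsUnit (1 - z • α)) :
    Ring.inverse (1 - z • α) = 1 + z • (α ∘L Ring.inverse (1 - z • α)) := by
  have := comp_inverse_self h
  rw [ContinuousLinearMap.sub_comp, ContinuousLinearMap.smul_comp, ContinuousLinearMap.one_def,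
    ContinuousLinearMap.id_comp, sub_eq_iff_eq_add] at this
  exact this

lemma eq_zero_of_comp_inverse {A : X →L[ℂ] X} (hA : IsUnit A) {B : X →L[ℂ] Y}
    (h : B ∘L Ring.inverse A = 0) : B = 0 := by
  have : B ∘L (Ring.inverse A ∘L A) = 0 := by
    rw [← ContinuousLinearMap.comp_assoc, h, ContinuousLinearMap.zero_comp]
  simpa [inverse_comp_self hA, ContinuousLinearMap.one_def] using this

/-- The homogeneous Stein equation with stable coefficients has only the trivial solution. -/
lemma eq_zero_of_stein [CompleteSpace X] [CompleteSpace Y] {α : Y →L[ℂ] Y} {β : X →L[ℂ] X}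
    (hα : ExponentiallyStable α) (hβ : ExponentiallyStable β) {Q : X →L[ℂ] Y}
    (h : Q - α ∘L Q ∘L β = 0) : Q = 0 := by
  -- the partial fractions of zero have an exterior part, which is thus constant and vanishes at
  -- infinity
  have key : ∀ z w : ℂ, ‖z‖ = 1 → z * w = 1 →
      -(Ring.inverse (1 - z • α) ∘L α ∘L Q) = w • (Q ∘L Ring.inverse (1 - w • β)) := by
    intro z w hz hzw
    have hw : ‖w‖ ≤ 1 := (norm_eq_one_of_mul_eq_one hz hzw).le
    have := inverse_comp_stein_comp_inverse hzw (exponentiallyStable_iff.1 hα z hz.le)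
      (exponentiallyStable_iff.1 hβ w hw) Q
    rw [h, ContinuousLinearMap.zero_comp, ContinuousLinearMap.comp_zero] at this
    rw [eq_neg_of_add_eq_zero_left this.symm, smul_neg, smul_smul, mul_comm w, hzw, one_smul]
  have h1 := eq_of_eq_on_circle (z := 1)
    (f := fun z => -(Ring.inverse (1 - z • α) ∘L α ∘L Q))
    (H := fun w => w • (Q ∘L Ring.inverse (1 - w • β)))
    (fun z hz => (analyticAt_clm_comp (analyticOnNhd_inverse_one_sub hα z hz)
      analyticAt_const).neg)
    (fun w hw => analyticAt_id.smul (analyticAt_clm_comp analyticAt_const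
      (analyticOnNhd_inverse_one_sub hβ w hw))) key (by simp)
  have h2 := (key 1 1 (by simp) (by simp)).symm.trans h1
  simp only [one_smul, zero_smul] at h2
  exact eq_zero_of_comp_inverse (by simpa using exponentiallyStable_iff.1 hβ 1 (by simp)) h2

/-- The Stein equation with stable coefficients is solvable. The solution is the remainder of
`(1 - z α)⁻¹ K` on right division by `z - β`. -/
lemma exists_stein [CompleteSpace X] [CompleteSpace Y] {α : Y →L[ℂ] Y} {β : X →L[ℂ] X}
    (hα : ExponentiallyStable α) (hβ : ExponentiallyStable β) (K : X →L[ℂ] Y) :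
    ∃ Q : X →L[ℂ] Y, Q - α ∘L Q ∘L β = K := by
  obtain ⟨Q, m, hm, hQ⟩ := exists_right_remainder hβ (V := fun z => Ring.inverse (1 - z • α) ∘L K)
    fun z hz => analyticAt_clm_comp (analyticOnNhd_inverse_one_sub hα z hz) analyticAt_const
  refine ⟨Q, ?_⟩
  have key : ∀ z w : ℂ, ‖z‖ = 1 → z * w = 1 →
      (1 - z • α) ∘L m z - α ∘L Q =
        w • ((K - (Q - α ∘L Q ∘L β)) ∘L Ring.inverse (1 - w • β)) := by
    intro z w hz hzw
    have hw : ‖w‖ ≤ 1 := (norm_eq_one_of_mul_eq_one hz hzw).le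
    have hαz := exponentiallyStable_iff.1 hα z hz.le
    have hβw := exponentiallyStable_iff.1 hβ w hw
    have e1 : K = (1 - z • α) ∘L (Q + (z • m z - m z ∘L β)) := by
      rw [← hQ z hz.le, ← ContinuousLinearMap.comp_assoc, comp_inverse_self hαz,
        ContinuousLinearMap.one_def, ContinuousLinearMap.id_comp]
    have e3 : K - (Q - α ∘L Q ∘L β) =
        z • (((1 - z • α) ∘L m z - α ∘L Q) ∘L (1 - w • β)) := by
      rw [smul_comp_one_sub _ _ hzw]
      nth_rw 1 [e1]
      simp only [ContinuousLinearMap.sub_comp, ContinuousLinearMap.comp_sub, smul_sub,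
        ContinuousLinearMap.comp_smul, ContinuousLinearMap.smul_comp, ContinuousLinearMap.one_def,
        ContinuousLinearMap.id_comp, ContinuousLinearMap.comp_add, ContinuousLinearMap.comp_assoc]
      module
    rw [e3, ContinuousLinearMap.smul_comp, smul_smul, mul_comm w, hzw, one_smul,
      ContinuousLinearMap.comp_assoc, comp_inverse_self hβw]
    exact (ContinuousLinearMap.comp_id _).symm
  have h0 := eq_of_eq_on_circle (z := 1)
    (f := fun z => (1 - z • α) ∘L m z - α ∘L Q)
    (H := fun w => w • ((K - (Q - α ∘L Q ∘L β)) ∘L Ring.inverse (1 - w • β)))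
    (fun z hz => (analyticAt_clm_comp (by fun_prop) (hm z hz)).sub analyticAt_const)
    (fun w hw => analyticAt_id.smul (analyticAt_clm_comp analyticAt_const
      (analyticOnNhd_inverse_one_sub hβ w hw))) key (by simp)
  have h2 := (key 1 1 (by simp) (by simp)).symm.trans h0
  simp only [one_smul, zero_smul] at h2
  exact (sub_eq_zero.1 (eq_zero_of_comp_inverse
    (by simpa using exponentiallyStable_iff.1 hβ 1 (by simp)) h2)).symm

/-- Inversion of a realization by a Schur complement. -/
lemma isUnit_and_inverse_realization {D : X →L[ℂ] X} {A : Y →L[ℂ] Y} {B : X →L[ℂ] Y}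
    {C : Y →L[ℂ] X} (hD : IsUnit D) (hA : IsUnit A)
    (hS : IsUnit (A + B ∘L Ring.inverse D ∘L C)) :
    IsUnit (D + C ∘L Ring.inverse A ∘L B) ∧
      Ring.inverse (D + C ∘L Ring.inverse A ∘L B) = Ring.inverse D -
        Ring.inverse D ∘L C ∘L Ring.inverse (A + B ∘L Ring.inverse D ∘L C) ∘L B ∘L
          Ring.inverse D := by
  set E := Ring.inverse D
  set G := Ring.inverse A
  set T := Ring.inverse (A + B ∘L E ∘L C)
  have d1 : ∀ x, D (E x) = x := fun x => DFunLike.congr_fun (comp_inverse_self hD) x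
  have d2 : ∀ x, E (D x) = x := fun x => DFunLike.congr_fun (inverse_comp_self hD) x
  have a1 : ∀ x, A (G x) = x := fun x => DFunLike.congr_fun (comp_inverse_self hA) x
  have a2 : ∀ x, G (A x) = x := fun x => DFunLike.congr_fun (inverse_comp_self hA) x
  have s1 : ∀ x, A (T x) + B (E (C (T x))) = x := fun x =>
    DFunLike.congr_fun (comp_inverse_self hS) x
  have s2 : ∀ x, T (A x) + T (B (E (C x))) = x := fun x => by
    rw [← map_add]; exact DFunLike.congr_fun (inverse_comp_self hS) x
  have m1 : (D + C ∘L G ∘L B) * (E - E ∘L C ∘L T ∘L B ∘L E) = 1 := by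
    ext x
    have := congrArg (fun y => C (G y)) (s1 (B (E x)))
    simp only [map_add, a2] at this
    simp only [mul_apply_eq_comp, add_apply,
      sub_apply, ContinuousLinearMap.comp_apply, map_sub, d1,
      one_apply_eq_self]
    rw [← this]; abel
  have m2 : (E - E ∘L C ∘L T ∘L B ∘L E) * (D + C ∘L G ∘L B) = 1 := by
    ext x
    have := congrArg (fun y => E (C y)) (s2 (G (B x)))
    simp only [map_add, a1] at this
    simp only [mul_apply_eq_comp, add_apply,
      sub_apply, ContinuousLinearMap.comp_apply, map_add, d2,
      one_apply_eq_self]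
    linear_combination (norm := module) (-1 : ℂ) • this
  let u : (X →L[ℂ] X)ˣ := ⟨_, _, m1, m2⟩
  exact ⟨u.isUnit, Ring.inverse_unit u⟩

end Resolvent

/-! ### Products of realizations and uniqueness of stabilizing solutions -/

section Product

variable {U X Y : Type*} [NormedAddCommGroup U] [InnerProductSpace ℂ U]
  [NormedAddCommGroup X] [InnerProductSpace ℂ X]
  [NormedAddCommGroup Y] [InnerProductSpace ℂ Y]

lemma inverse_comp_smul_sub {α : Y →L[ℂ] Y} {z w : ℂ} (h : z * w = 1)
    (hα : IsUnit (1 - z • α)) (T : U →L[ℂ] Y) :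
    Ring.inverse (1 - z • α) ∘L (w • T - α ∘L T) = w • T := by
  have : w • T - α ∘L T = w • ((1 - z • α) ∘L T) := by
    rw [ContinuousLinearMap.sub_comp, ContinuousLinearMap.smul_comp, smul_sub, smul_smul,
      mul_comm, h, one_smul]
    rfl
  rw [this, ContinuousLinearMap.comp_smul, ← ContinuousLinearMap.comp_assoc, inverse_comp_self hα]
  rfl

lemma smul_sub_comp_inverse {α : X →L[ℂ] X} {z w : ℂ} (h : z * w = 1)
    (hα : IsUnit (1 - w • α)) (T : X →L[ℂ] U) :
    (z • T - T ∘L α) ∘L Ring.inverse (1 - w • α) = z • T := by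
  rw [← smul_comp_one_sub T α h, ContinuousLinearMap.smul_comp, ContinuousLinearMap.comp_assoc,
    comp_inverse_self hα]
  rfl

/-- The product of a realization analytic inside the disc and one analytic outside splits into its
two parts by means of the solution `Q` of the Stein equation `Q - α₊ Q α₋ = b c`. -/
lemma realization_comp_realization {αp : Y →L[ℂ] Y} {αm : X →L[ℂ] X} {z w : ℂ} (h : z * w = 1)
    (hαp : IsUnit (1 - z • αp)) (hαm : IsUnit (1 - w • αm)) {Q : X →L[ℂ] Y} {P₀ N₀ : U →L[ℂ] U}
    {γp : Y →L[ℂ] U} {βm : U →L[ℂ] X} {b : U →L[ℂ] Y} {c : X →L[ℂ] U}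
    (hQ : Q - αp ∘L Q ∘L αm = b ∘L c) :
    (P₀ + z • (γp ∘L Ring.inverse (1 - z • αp) ∘L b)) ∘L
        (N₀ + w • (c ∘L Ring.inverse (1 - w • αm) ∘L βm)) =
      P₀ ∘L N₀ + γp ∘L Q ∘L βm
        + z • (γp ∘L Ring.inverse (1 - z • αp) ∘L (b ∘L N₀ + αp ∘L Q ∘L βm))
        + w • ((P₀ ∘L c + γp ∘L Q ∘L αm) ∘L Ring.inverse (1 - w • αm) ∘L βm) := by
  have e1 := inverse_comp_stein_comp_inverse h hαp hαm Q
  have e2 := congrArg (fun T => γp ∘L (Q ∘L T) ∘L βm) (inverse_one_sub_smul_eq hαm)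
  rw [hQ] at e1
  replace e1 := congrArg (fun T => γp ∘L T ∘L βm) e1
  simp only [ContinuousLinearMap.add_comp, ContinuousLinearMap.comp_add,
    ContinuousLinearMap.comp_smul, ContinuousLinearMap.smul_comp, ContinuousLinearMap.comp_assoc,
    ContinuousLinearMap.one_def, ContinuousLinearMap.id_comp] at e1 e2 ⊢
  linear_combination (norm := module) e1 + e2 +
    h • (γp ∘L Ring.inverse (ContinuousLinearMap.id ℂ Y - z • αp) ∘L b ∘L c ∘L
      Ring.inverse (ContinuousLinearMap.id ℂ X - w • αm) ∘L βm)

end Product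

namespace StableData

variable {U Xp Xm : Type*}
  [NormedAddCommGroup U] [InnerProductSpace ℂ U]
  [NormedAddCommGroup Xp] [InnerProductSpace ℂ Xp]
  [NormedAddCommGroup Xm] [InnerProductSpace ℂ Xm]

lemma eval_eq (S : StableData U Xp Xm) {z w : ℂ} (h : z * w = 1) :
    S.eval z = S.δ + z • (S.γp ∘L Ring.inverse (1 - z • S.αp) ∘L S.βp)
      + w • (S.γm ∘L Ring.inverse (1 - w • S.αm) ∘L S.βm) := by
  rw [eval, inverse_smul_one_sub _ h, ContinuousLinearMap.smul_comp,
    ContinuousLinearMap.comp_smul]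

/-- The difference `X` of two solutions of the Riccati equation satisfies `X = α₊° X α₋°`, where
`α₊°` belongs to the first solution and `α₋°` to the second. -/
lemma stein_of_riccati (S : StableData U Xp Xm) {Q₁ Q₂ : Xm →L[ℂ] Xp}
    (h₁ : S.IsStabilizingSolution Q₁) (h₂ : S.IsStabilizingSolution Q₂) :
    (Q₁ - Q₂) - S.αpCirc Q₁ ∘L (Q₁ - Q₂) ∘L S.αmCirc Q₂ = 0 := by
  have i₁ : ∀ x, Ring.inverse (S.pivot Q₁) (S.pivot Q₁ x) = x := fun x =>
    DFunLike.congr_fun (inverse_comp_self h₁.isUnit_pivot) x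
  have i₂ : ∀ x, S.pivot Q₂ (Ring.inverse (S.pivot Q₂) x) = x := fun x =>
    DFunLike.congr_fun (comp_inverse_self h₂.isUnit_pivot) x
  ext x
  have e₁ := DFunLike.congr_fun h₁.riccati x
  have e₂ := DFunLike.congr_fun h₂.riccati x
  -- the resolvent identity `p₁⁻¹ - p₂⁻¹ = p₁⁻¹ (p₂ - p₁) p₂⁻¹` for the two pivots
  have e₃ := i₁ (Ring.inverse (S.pivot Q₂) (S.rowOp Q₂ x))
  have e₄ := i₂ (S.rowOp Q₂ x)
  replace e₃ := congrArg (S.colOp Q₁) e₃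
  replace e₄ := congrArg (fun y => S.colOp Q₁ (Ring.inverse (S.pivot Q₁) y)) e₄
  simp only [αpCirc, αmCirc] at *
  generalize Ring.inverse (S.pivot Q₁) = E₁ at *
  generalize Ring.inverse (S.pivot Q₂) = E₂ at *
  simp only [pivot, colOp, rowOp, sub_apply, add_apply, ContinuousLinearMap.comp_apply, map_sub,
    zero_apply] at *
  linear_combination (norm := module) e₁ - e₂ + e₃ - e₄

lemma IsStabilizingSolution.unique [CompleteSpace Xp] [CompleteSpace Xm]
    {S : StableData U Xp Xm} {Q₁ Q₂ : Xm →L[ℂ] Xp}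
    (h₁ : S.IsStabilizingSolution Q₁) (h₂ : S.IsStabilizingSolution Q₂) : Q₁ = Q₂ :=
  sub_eq_zero.1 (eq_zero_of_stein h₁.stable_p h₂.stable_m (S.stein_of_riccati h₁ h₂))

/-! ### The factorization defined by a stabilizing solution -/

section Realization

variable {S : StableData U Xp Xm} {Q : Xm →L[ℂ] Xp} {δp δm : U →L[ℂ] U}

lemma one_sub_smul_αpCirc (hp : IsUnit δp) (h : δp ∘L δm = S.pivot Q) (z : ℂ) :
    1 - z • S.αpCirc Q =
      (1 - z • S.αp) + (z • S.βpCirc Q δm) ∘L Ring.inverse δp ∘L S.γp := by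
  have : Ring.inverse (S.pivot Q) = Ring.inverse δm ∘L Ring.inverse δp := by
    rw [← h]; exact Ring.inverse_mul (Or.inl hp)
  rw [αpCirc, βpCirc, this]
  simp only [ContinuousLinearMap.smul_comp, ContinuousLinearMap.comp_assoc, smul_sub]
  abel

lemma smul_one_sub_αmCirc (hp : IsUnit δp) (h : δp ∘L δm = S.pivot Q) (z : ℂ) :
    z • 1 - S.αmCirc Q = (z • 1 - S.αm) + S.βm ∘L Ring.inverse δm ∘L S.γmCirc Q δp := by
  have : Ring.inverse (S.pivot Q) = Ring.inverse δm ∘L Ring.inverse δp := by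
    rw [← h]; exact Ring.inverse_mul (Or.inl hp)
  rw [αmCirc, γmCirc, this]
  simp only [ContinuousLinearMap.comp_assoc]
  abel

lemma Wp_eq (z : ℂ) :
    S.Wp Q δp δm z = δp + S.γp ∘L Ring.inverse (1 - z • S.αp) ∘L (z • S.βpCirc Q δm) := by
  simp only [Wp, ContinuousLinearMap.comp_smul]

lemma Wm_eq {z w : ℂ} (h : z * w = 1) :
    S.Wm Q δp δm z =
      δm + w • (S.γmCirc Q δp ∘L Ring.inverse (1 - w • S.αm) ∘L S.βm) := by
  rw [Wm, inverse_smul_one_sub _ h, ContinuousLinearMap.smul_comp, ContinuousLinearMap.comp_smul]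

lemma isUnit_Wp_and_inverse (hQ : S.IsStabilizingSolution Q) (hp : IsUnit δp)
    (h : δp ∘L δm = S.pivot Q) {z : ℂ} (hz : ‖z‖ ≤ 1) :
    IsUnit (S.Wp Q δp δm z) ∧ Ring.inverse (S.Wp Q δp δm z) = S.WpInv Q δp δm z := by
  have hs := exponentiallyStable_iff.1 hQ.stable_p z hz
  rw [one_sub_smul_αpCirc hp h] at hs
  obtain ⟨h1, h2⟩ := isUnit_and_inverse_realization hp
    (exponentiallyStable_iff.1 S.stable_p z hz) hs
  rw [Wp_eq]
  refine ⟨h1, h2.trans ?_⟩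
  rw [WpInv, one_sub_smul_αpCirc hp h]
  simp only [ContinuousLinearMap.smul_comp, ContinuousLinearMap.comp_smul]

lemma isUnit_Wm_and_inverse (hQ : S.IsStabilizingSolution Q) (hp : IsUnit δp) (hm : IsUnit δm)
    (h : δp ∘L δm = S.pivot Q) {z : ℂ} (hz : 1 ≤ ‖z‖) :
    IsUnit (S.Wm Q δp δm z) ∧ Ring.inverse (S.Wm Q δp δm z) = S.WmInv Q δp δm z := by
  have hs := isUnit_smul_one_sub hQ.stable_m hz
  rw [smul_one_sub_αmCirc hp h] at hs
  rw [WmInv, smul_one_sub_αmCirc hp h]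
  exact isUnit_and_inverse_realization hm (isUnit_smul_one_sub S.stable_m hz) hs

/-- At points where both resolvents exist, the Riccati equation says that `W₊ W₋` is the function
represented by the data. -/
lemma Wp_comp_Wm (hQ : S.IsStabilizingSolution Q) (hp : IsUnit δp) (hm : IsUnit δm)
    (h : δp ∘L δm = S.pivot Q) {z w : ℂ} (hzw : z * w = 1) (hαp : IsUnit (1 - z • S.αp))
    (hαm : IsUnit (1 - w • S.αm)) :
    S.Wp Q δp δm z ∘L S.Wm Q δp δm z = S.eval z := by
  have hinv : Ring.inverse (S.pivot Q) = Ring.inverse δm ∘L Ring.inverse δp := by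
    rw [← h]; exact Ring.inverse_mul (Or.inl hp)
  have hst : Q - S.αp ∘L Q ∘L S.αm = S.βpCirc Q δm ∘L S.γmCirc Q δp := by
    rw [sub_eq_iff_eq_add']
    refine hQ.riccati.trans ?_
    rw [hinv, βpCirc, γmCirc]
    simp only [ContinuousLinearMap.comp_assoc]
  have hb : S.βpCirc Q δm ∘L δm = S.colOp Q := by
    rw [βpCirc, ContinuousLinearMap.comp_assoc, inverse_comp_self hm]; rfl
  have hc : δp ∘L S.γmCirc Q δp = S.rowOp Q := by
    rw [γmCirc, ← ContinuousLinearMap.comp_assoc, comp_inverse_self hp]; rfl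
  rw [Wp, Wm_eq hzw, realization_comp_realization hzw hαp hαm hst, h, hb, hc, pivot, colOp, rowOp,
    sub_add_cancel, sub_add_cancel, sub_add_cancel, eval_eq S hzw]

/-- A stabilizing solution yields a canonical factorization. -/
lemma isLeftCanonicalFactorization [CompleteSpace U] [CompleteSpace Xp] [CompleteSpace Xm]
    {R : ℂ → U →L[ℂ] U} (hS : S.Represents R) (hQ : S.IsStabilizingSolution Q)
    (hp : IsUnit δp) (hm : IsUnit δm) (h : δp ∘L δm = S.pivot Q) :
    IsLeftCanonicalFactorization R (S.Wp Q δp δm) (S.Wm Q δp δm) := by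
  have hWp : AnalyticOnNhd ℂ (S.Wp Q δp δm) {z | ‖z‖ ≤ 1} := fun z hz =>
    analyticAt_const.add (analyticAt_id.smul (analyticAt_clm_comp analyticAt_const
      (analyticAt_clm_comp (analyticOnNhd_inverse_one_sub S.stable_p z hz) analyticAt_const)))
  have hWm : AnalyticOnNhd ℂ (S.Wm Q δp δm) {z | 1 ≤ ‖z‖} := fun z hz =>
    analyticAt_const.add (analyticAt_clm_comp analyticAt_const (analyticAt_clm_comp
      (analyticAt_ringInverse (by fun_prop) (isUnit_smul_one_sub S.stable_m hz)) analyticAt_const))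
  refine ⟨⟨hWp, fun z hz => (isUnit_Wp_and_inverse hQ hp h hz).1, fun z hz =>
    analyticAt_ringInverse (hWp z hz) (isUnit_Wp_and_inverse hQ hp h hz).1⟩,
    ⟨hWm, fun z hz => (isUnit_Wm_and_inverse hQ hp hm h hz).1, fun z hz =>
    analyticAt_ringInverse (hWm z hz) (isUnit_Wm_and_inverse hQ hp hm h hz).1, δm, hm, ?_⟩, ?_⟩
  · -- `W₋` in the coordinate `w = 1 / z` at infinity
    set N : ℂ → U →L[ℂ] U := fun w =>
      δm + w • (S.γmCirc Q δp ∘L Ring.inverse (1 - w • S.αm) ∘L S.βm) with hN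
    have hNa : AnalyticAt ℂ N 0 :=
      analyticAt_const.add (analyticAt_id.smul (analyticAt_clm_comp analyticAt_const
        (analyticAt_clm_comp (analyticOnNhd_inverse_one_sub S.stable_m 0 (by simp))
          analyticAt_const)))
    have hN0 : N 0 = δm := by simp [hN]
    have e : ∀ w ≠ 0, S.Wm Q δp δm w⁻¹ = N w := fun w hw => Wm_eq (inv_mul_cancel₀ hw)
    have e1 : Function.update (fun z : ℂ => S.Wm Q δp δm z⁻¹) 0 δm = N := by
      funext w
      rcases eq_or_ne w 0 with rfl | hw
      · rw [Function.update_self, hN0]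
      · rw [Function.update_of_ne hw, e w hw]
    have e2 : Function.update (fun z : ℂ => Ring.inverse (S.Wm Q δp δm z⁻¹)) 0 (Ring.inverse δm) =
        fun w => Ring.inverse (N w) := by
      funext w
      rcases eq_or_ne w 0 with rfl | hw
      · rw [Function.update_self, hN0]
      · rw [Function.update_of_ne hw, e w hw]
    rw [e1, e2]
    exact ⟨hNa, analyticAt_ringInverse hNa (hN0 ▸ hm)⟩
  · have hnear : ∀ᶠ z in 𝓝ˢ (Metric.sphere (0 : ℂ) 1),
        z ≠ 0 ∧ IsUnit (1 - z • S.αp) ∧ IsUnit (1 - z⁻¹ • S.αm) := by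
      rw [eventually_nhdsSet_iff_forall]
      intro z hz
      have hz1 : ‖z‖ = 1 := by simpa using hz
      have hz0 : z ≠ 0 := by rintro rfl; norm_num at hz1
      have c1 : ContinuousAt (fun z : ℂ => 1 - z • S.αp) z := by fun_prop
      have c2 : ContinuousAt (fun z : ℂ => 1 - z⁻¹ • S.αm) z := by fun_prop (disch := assumption)
      exact (eventually_ne_nhds hz0).and
        ((c1.eventually (Units.isOpen.mem_nhds (exponentiallyStable_iff.1 S.stable_p z hz1.le))).and
        (c2.eventually (Units.isOpen.mem_nhds
          (exponentiallyStable_iff.1 S.stable_m z⁻¹ (by simp [hz1])))))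
    filter_upwards [hS, hnear] with z hz ⟨hz0, hαp, hαm⟩
    rw [hz, Wp_comp_Wm hQ hp hm h (mul_inv_cancel₀ hz0) hαp hαm]

end Realization

/-! ### The stabilizing solution defined by a factorization -/

/-- A canonical factorization, with the exterior factor `N` and its inverse written in the
coordinate `w = 1 / z`, yields a stabilizing solution. -/
theorem exists_isStabilizingSolution [CompleteSpace U] [CompleteSpace Xp] [CompleteSpace Xm]
    (S : StableData U Xp Xm) {P P' N N' : ℂ → U →L[ℂ] U}
    (hP : AnalyticOnNhd ℂ P {z | ‖z‖ ≤ 1}) (hP' : AnalyticOnNhd ℂ P' {z | ‖z‖ ≤ 1})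
    (hN : AnalyticOnNhd ℂ N {z | ‖z‖ ≤ 1}) (hN' : AnalyticOnNhd ℂ N' {z | ‖z‖ ≤ 1})
    (hPP' : ∀ z : ℂ, ‖z‖ ≤ 1 → P z ∘L P' z = 1) (hP'P : ∀ z : ℂ, ‖z‖ ≤ 1 → P' z ∘L P z = 1)
    (hNN' : ∀ z : ℂ, ‖z‖ ≤ 1 → N z ∘L N' z = 1) (hN'N : ∀ z : ℂ, ‖z‖ ≤ 1 → N' z ∘L N z = 1)
    (hfac : ∀ z w : ℂ, ‖z‖ = 1 → z * w = 1 → S.eval z = P z ∘L N w) :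
    ∃ Q : Xm →L[ℂ] Xp, S.IsStabilizingSolution Q := by
  have hRp := analyticOnNhd_inverse_one_sub S.stable_p
  have hRm := analyticOnNhd_inverse_one_sub S.stable_m
  have hup := exponentiallyStable_iff.1 S.stable_p
  have hum := exponentiallyStable_iff.1 S.stable_m
  have hPu : ∀ z : ℂ, ‖z‖ ≤ 1 → IsUnit (P z) := fun z hz =>
    (⟨P z, P' z, hPP' z hz, hP'P z hz⟩ : (U →L[ℂ] U)ˣ).isUnit
  have hNu : ∀ z : ℂ, ‖z‖ ≤ 1 → IsUnit (N z) := fun z hz =>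
    (⟨N z, N' z, hNN' z hz, hN'N z hz⟩ : (U →L[ℂ] U)ˣ).isUnit
  obtain ⟨b, n, hn, hb⟩ := exists_left_remainder S.stable_p (V := fun w => S.βp ∘L N' w)
    fun w hw => analyticAt_clm_comp analyticAt_const (hN' w hw)
  obtain ⟨c, p, hp, hc⟩ := exists_right_remainder S.stable_m (V := fun z => P' z ∘L S.γm)
    fun z hz => analyticAt_clm_comp (hP' z hz) analyticAt_const
  obtain ⟨Q, hQ⟩ := exists_stein S.stable_p S.stable_m (b ∘L c)
  -- interior and exterior parts of `P = R N⁻¹`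
  have hPeq : ∀ z : ℂ, ‖z‖ ≤ 1 →
      P z = P 0 + z • (S.γp ∘L Ring.inverse (1 - z • S.αp) ∘L b) := by
    have key := fun z (hz : ‖z‖ ≤ 1) => eq_of_eq_on_circle (z := z)
      (f := fun z => P z - z • (S.γp ∘L Ring.inverse (1 - z • S.αp) ∘L b))
      (H := fun w => S.δ ∘L N' w + S.γp ∘L n w +
        w • (S.γm ∘L Ring.inverse (1 - w • S.αm) ∘L S.βm ∘L N' w))
      (fun z hz => (hP z hz).sub (analyticAt_id.smul (analyticAt_clm_comp analyticAt_const
        (analyticAt_clm_comp (hRp z hz) analyticAt_const))))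
      (fun w hw => ((analyticAt_clm_comp analyticAt_const (hN' w hw)).add
        (analyticAt_clm_comp analyticAt_const (hn w hw))).add
        (analyticAt_id.smul (analyticAt_clm_comp analyticAt_const (analyticAt_clm_comp (hRm w hw)
          (analyticAt_clm_comp analyticAt_const (hN' w hw))))))
      (by
        intro z w hz hzw
        have hw := (norm_eq_one_of_mul_eq_one hz hzw).le
        have e1 := congrArg (· ∘L N' w) (hfac z w hz hzw)
        have e2 := congrArg (fun T => S.γp ∘L Ring.inverse (1 - z • S.αp) ∘L T) (hb w hw)
        have e3 := congrArg (fun T => S.γp ∘L T) (inverse_comp_smul_sub hzw (hup z hz.le) (n w))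
        simp only [eval_eq S hzw, ContinuousLinearMap.add_comp, ContinuousLinearMap.comp_add,
          ContinuousLinearMap.comp_smul, ContinuousLinearMap.smul_comp,
          ContinuousLinearMap.comp_assoc, hNN' w hw] at e1 e2 e3 ⊢
        replace e1 := e1.trans (ContinuousLinearMap.comp_id (P z))
        linear_combination (norm := module) -e1 + z • e2 + z • e3 + hzw • (S.γp ∘L n w)) hz
    intro z hz
    have h0 := (key z hz).trans (key 0 (by simp)).symm
    simp only [zero_smul, sub_zero] at h0
    exact sub_eq_iff_eq_add.1 h0
  -- interior and exterior parts of `N = P⁻¹ R`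
  have hNeq : ∀ w : ℂ, ‖w‖ ≤ 1 →
      N w = N 0 + w • (c ∘L Ring.inverse (1 - w • S.αm) ∘L S.βm) := by
    have key := fun z (hz : ‖z‖ ≤ 1) => eq_of_eq_on_circle (z := z)
      (f := fun w => N w - w • (c ∘L Ring.inverse (1 - w • S.αm) ∘L S.βm))
      (H := fun z => P' z ∘L S.δ + z • (P' z ∘L S.γp ∘L Ring.inverse (1 - z • S.αp) ∘L S.βp) +
        p z ∘L S.βm)
      (fun w hw => (hN w hw).sub (analyticAt_id.smul (analyticAt_clm_comp analyticAt_const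
        (analyticAt_clm_comp (hRm w hw) analyticAt_const))))
      (fun z hz => ((analyticAt_clm_comp (hP' z hz) analyticAt_const).add
        (analyticAt_id.smul (analyticAt_clm_comp (hP' z hz) (analyticAt_clm_comp analyticAt_const
          (analyticAt_clm_comp (hRp z hz) analyticAt_const))))).add
        (analyticAt_clm_comp (hp z hz) analyticAt_const))
      (by
        intro w z hw hwz
        have hzw : z * w = 1 := by rw [mul_comm, hwz]
        have hz := norm_eq_one_of_mul_eq_one hw hwz
        have e1 := congrArg (P' z ∘L ·) (hfac z w hz hzw)
        have e2 := congrArg (fun T => T ∘L Ring.inverse (1 - w • S.αm) ∘L S.βm) (hc z hz.le)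
        have e3 := congrArg (fun T => T ∘L S.βm) (smul_sub_comp_inverse hzw (hum w hw.le) (p z))
        have e4 : P' z ∘L P z ∘L N w = N w := by
          rw [← ContinuousLinearMap.comp_assoc, hP'P z hz.le]; rfl
        simp only [eval_eq S hzw, ContinuousLinearMap.add_comp, ContinuousLinearMap.comp_add,
          ContinuousLinearMap.comp_smul, ContinuousLinearMap.smul_comp,
          ContinuousLinearMap.comp_assoc, e4] at e1 e2 e3 ⊢
        linear_combination (norm := module) -e1 + w • e2 + w • e3 + hzw • (p z ∘L S.βm)) hz
    intro z hz
    have h0 := (key z hz).trans (key 0 (by simp)).symm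
    simp only [zero_smul, sub_zero] at h0
    exact sub_eq_iff_eq_add.1 h0
  -- interior and exterior parts of `(1 - z α₊)⁻¹ β₊ = (1 - z α₊)⁻¹ β₊ N⁻¹ N`; the exterior part
  -- vanishes at infinity
  have hcol : S.βp - S.αp ∘L Q ∘L S.βm = b ∘L N 0 := by
    have key := eq_of_eq_on_circle (z := 0)
      (f := fun z => Ring.inverse (1 - z • S.αp) ∘L
        (S.βp - b ∘L N 0 - S.αp ∘L Q ∘L S.βm))
      (H := fun w => w • (Q ∘L Ring.inverse (1 - w • S.αm) ∘L S.βm + n w ∘L N w))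
      (fun z hz => analyticAt_clm_comp (hRp z hz) analyticAt_const)
      (fun w hw => analyticAt_id.smul ((analyticAt_clm_comp analyticAt_const
        (analyticAt_clm_comp (hRm w hw) analyticAt_const)).add
        (analyticAt_clm_comp (hn w hw) (hN w hw))))
      (by
        intro z w hz hzw
        have hw := (norm_eq_one_of_mul_eq_one hz hzw).le
        have e1 := congrArg (fun T => Ring.inverse (1 - z • S.αp) ∘L T ∘L N w) (hb w hw)
        have e2 := congrArg (fun T => T ∘L N w) (inverse_comp_smul_sub hzw (hup z hz.le) (n w))
        have e3 := inverse_comp_stein_comp_inverse hzw (hup z hz.le) (hum w hw) Q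
        rw [hQ] at e3
        replace e3 := congrArg (fun T => T ∘L S.βm) e3
        have e4 : S.βp ∘L N' w ∘L N w = S.βp := by rw [hN'N w hw]; rfl
        have e5 := congrArg (fun T => Ring.inverse (1 - z • S.αp) ∘L b ∘L T) (hNeq w hw)
        simp only [ContinuousLinearMap.add_comp, ContinuousLinearMap.comp_add,
          ContinuousLinearMap.comp_sub, ContinuousLinearMap.sub_comp,
          ContinuousLinearMap.comp_smul, ContinuousLinearMap.smul_comp,
          ContinuousLinearMap.comp_assoc, e4] at e1 e2 e3 e5 ⊢
        linear_combination (norm := module) e1 + e2 + w • e3 + e5 +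
          hzw • (Ring.inverse (1 - z • S.αp) ∘L S.αp ∘L Q ∘L S.βm)) (by simp)
    simp only [zero_smul, sub_zero, Ring.inverse_one] at key
    have key' : S.βp - b ∘L N 0 - S.αp ∘L Q ∘L S.βm = 0 := key
    rw [sub_right_comm] at key'
    exact sub_eq_zero.1 key'
  -- interior and exterior parts of `γ₋ (1 - w α₋)⁻¹ = P P⁻¹ γ₋ (1 - w α₋)⁻¹`; the interior part
  -- vanishes at zero
  have hrow : S.γm - S.γp ∘L Q ∘L S.αm = P 0 ∘L c := by
    have key := fun w (hw : ‖w‖ ≤ 1) => eq_of_eq_on_circle (z := w)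
      (f := fun w => (S.γm - P 0 ∘L c - S.γp ∘L Q ∘L S.αm) ∘L Ring.inverse (1 - w • S.αm))
      (H := fun z => z • (S.γp ∘L Q + z • (S.γp ∘L Ring.inverse (1 - z • S.αp) ∘L S.αp ∘L Q) +
        P z ∘L p z))
      (fun w hw => analyticAt_clm_comp analyticAt_const (hRm w hw))
      (fun z hz => analyticAt_id.smul ((analyticAt_const.add (analyticAt_id.smul
        (analyticAt_clm_comp analyticAt_const (analyticAt_clm_comp (hRp z hz)
          analyticAt_const)))).add (analyticAt_clm_comp (hP z hz) (hp z hz))))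
      (by
        intro w z hw hwz
        have hzw : z * w = 1 := by rw [mul_comm, hwz]
        have hz := norm_eq_one_of_mul_eq_one hw hwz
        have e1 := congrArg (fun T => P z ∘L T ∘L Ring.inverse (1 - w • S.αm)) (hc z hz.le)
        have e2 := congrArg (fun T => P z ∘L T) (smul_sub_comp_inverse hzw (hum w hw.le) (p z))
        have e3 := inverse_comp_stein_comp_inverse hzw (hup z hz.le) (hum w hw.le) Q
        rw [hQ] at e3
        replace e3 := congrArg (fun T => S.γp ∘L T) e3
        have e4 : P z ∘L P' z ∘L S.γm ∘L Ring.inverse (1 - w • S.αm) =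
            S.γm ∘L Ring.inverse (1 - w • S.αm) := by
          rw [← ContinuousLinearMap.comp_assoc, hPP' z hz.le]; rfl
        have e5 := congrArg (fun T => T ∘L c ∘L Ring.inverse (1 - w • S.αm)) (hPeq z hz.le)
        have e6 := congrArg (fun T => S.γp ∘L Q ∘L T) (inverse_one_sub_smul_eq (hum w hw.le))
        have e7 : S.γp ∘L Q ∘L (1 : Xm →L[ℂ] Xm) = S.γp ∘L Q := rfl
        simp only [ContinuousLinearMap.add_comp, ContinuousLinearMap.comp_add,
          ContinuousLinearMap.comp_sub, ContinuousLinearMap.sub_comp,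
          ContinuousLinearMap.comp_smul, ContinuousLinearMap.smul_comp,
          ContinuousLinearMap.comp_assoc, e4] at e1 e2 e3 e5 e6 ⊢
        rw [e7] at e6
        linear_combination (norm := module) e1 + e2 + z • e3 + e5 + z • e6 +
          hzw • (S.γp ∘L Q ∘L S.αm ∘L Ring.inverse (1 - w • S.αm))) hw
    have h1 := key 1 (by simp)
    simp only [zero_smul] at h1
    have h2 := eq_zero_of_comp_inverse (hum 1 (by simp)) h1
    rw [sub_right_comm] at h2
    exact sub_eq_zero.1 h2
  -- `z = 1` is a point of the circle at which `R` can be compared with the split product `P N`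
  have hpiv : P 0 ∘L N 0 = S.pivot Q := by
    have e1 := hfac 1 1 (by simp) (by simp)
    have hu1 := hup 1 (by simp)
    have hu2 := hum 1 (by simp)
    rw [hPeq 1 (by simp), hNeq 1 (by simp), realization_comp_realization (mul_one 1) hu1 hu2 hQ,
      ← hcol, ← hrow, sub_add_cancel, sub_add_cancel, eval_eq S (mul_one 1)] at e1
    exact eq_sub_of_add_eq (add_right_cancel (add_right_cancel e1)).symm
  have hP0 := hPu 0 (by simp)
  have hN0 := hNu 0 (by simp)
  have hbeq : S.βpCirc Q (N 0) = b := by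
    rw [βpCirc, colOp, hcol, ContinuousLinearMap.comp_assoc, comp_inverse_self hN0]; rfl
  have hceq : S.γmCirc Q (P 0) = c := by
    rw [γmCirc, rowOp, hrow, ← ContinuousLinearMap.comp_assoc, inverse_comp_self hP0]; rfl
  refine ⟨Q, ?_, ?_, ?_, ?_⟩
  · rw [← hpiv]; exact hP0.mul hN0
  · have hinv : Ring.inverse (S.pivot Q) = Ring.inverse (N 0) ∘L Ring.inverse (P 0) := by
      rw [← hpiv]; exact Ring.inverse_mul (Or.inl hP0)
    have : S.colOp Q ∘L Ring.inverse (S.pivot Q) ∘L S.rowOp Q = b ∘L c := by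
      rw [← hbeq, ← hceq, βpCirc, γmCirc, hinv]
      simp only [ContinuousLinearMap.comp_assoc]
    rw [this, ← hQ]
    abel
  · -- `1 - w α₋°` is a Schur complement of `N w`
    refine exponentiallyStable_iff.2 fun w hw => ?_
    rcases eq_or_ne w 0 with rfl | hw0
    · simp
    have h1 : 1 - w • S.αmCirc Q = w • (w⁻¹ • 1 - S.αmCirc Q) := by
      rw [smul_sub, smul_smul, mul_inv_cancel₀ hw0, one_smul]
    have h2 : (1 - w • S.αm) + (w • S.βm) ∘L Ring.inverse (N 0) ∘L c = 1 - w • S.αmCirc Q := by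
      rw [h1, smul_one_sub_αmCirc hP0 hpiv, hceq, smul_add, smul_sub, smul_smul,
        mul_inv_cancel₀ hw0, one_smul, ContinuousLinearMap.smul_comp]
    rw [← h2]
    refine (isUnit_and_inverse_realization (hum w hw) hN0 ?_).1
    rw [ContinuousLinearMap.comp_smul, ContinuousLinearMap.comp_smul, ← hNeq w hw]
    exact hNu w hw
  · -- `1 - z α₊°` is a Schur complement of `P z`
    refine exponentiallyStable_iff.2 fun z hz => ?_
    rw [one_sub_smul_αpCirc hP0 hpiv, hbeq]
    refine (isUnit_and_inverse_realization (hup z hz) hP0 ?_).1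
    rw [ContinuousLinearMap.comp_smul, ContinuousLinearMap.comp_smul, ← hPeq z hz]
    exact hPu z hz

end StableData

/-- An exterior factor and its inverse, in the coordinate `w = 1 / z`, are inverse to each other
and analytic on the closed unit disc. -/
lemma IsExteriorFactor.exists_coordinate {U : Type*} [NormedAddCommGroup U]
    [InnerProductSpace ℂ U] {W : ℂ → U →L[ℂ] U} (hW : IsExteriorFactor W) :
    ∃ N N' : ℂ → U →L[ℂ] U, AnalyticOnNhd ℂ N {z | ‖z‖ ≤ 1} ∧
      AnalyticOnNhd ℂ N' {z | ‖z‖ ≤ 1} ∧ (∀ z : ℂ, ‖z‖ ≤ 1 → N z ∘L N' z = 1) ∧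
      (∀ z : ℂ, ‖z‖ ≤ 1 → N' z ∘L N z = 1) ∧ ∀ z w : ℂ, z * w = 1 → N w = W z := by
  obtain ⟨Winf, hu, ha, hai⟩ := hW.at_infinity
  have hext : ∀ w : ℂ, w ≠ 0 → ‖w‖ ≤ 1 → 1 ≤ ‖w⁻¹‖ := fun w hw0 hw => by
    rw [norm_inv]; exact (one_le_inv₀ (norm_pos_iff.2 hw0)).2 hw
  have hana : ∀ {V : ℂ → U →L[ℂ] U} {Vinf : U →L[ℂ] U}, AnalyticOnNhd ℂ V {z | 1 ≤ ‖z‖} →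
      AnalyticAt ℂ (Function.update (fun z : ℂ => V z⁻¹) 0 Vinf) 0 →
      AnalyticOnNhd ℂ (Function.update (fun z : ℂ => V z⁻¹) 0 Vinf) {z | ‖z‖ ≤ 1} := by
    intro V Vinf hV h0 w hw
    rcases eq_or_ne w 0 with rfl | hw0
    · exact h0
    · have h1 : AnalyticAt ℂ (fun z : ℂ => V z⁻¹) w :=
        (hV w⁻¹ (hext w hw0 hw)).comp (f := fun z : ℂ => z⁻¹) (analyticAt_id.inv hw0)
      refine h1.congr ?_
      filter_upwards [eventually_ne_nhds hw0] with y hy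
      rw [Function.update_of_ne hy]
  refine ⟨_, _, hana hW.analytic ha, hana hW.analytic_inv hai, fun z hz => ?_, fun z hz => ?_,
    fun z w h => ?_⟩
  · rcases eq_or_ne z 0 with rfl | hz0
    · simpa using comp_inverse_self hu
    · simpa [Function.update_of_ne hz0] using comp_inverse_self (hW.isUnit _ (hext z hz0 hz))
  · rcases eq_or_ne z 0 with rfl | hz0
    · simpa using inverse_comp_self hu
    · simpa [Function.update_of_ne hz0] using inverse_comp_self (hW.isUnit _ (hext z hz0 hz))
  · rw [Function.update_of_ne (right_ne_zero_of_mul_eq_one h), ← eq_inv_of_mul_eq_one_left h]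

end WienerHopf

theorem mainTheorem2 {U Xp Xm : Type*}
    [NormedAddCommGroup U] [InnerProductSpace ℂ U] [CompleteSpace U]
    [NormedAddCommGroup Xp] [InnerProductSpace ℂ Xp] [CompleteSpace Xp]
    [NormedAddCommGroup Xm] [InnerProductSpace ℂ Xm] [CompleteSpace Xm]
    (R : ℂ → U →L[ℂ] U)
    (hR : ∀ᶠ z in 𝓝ˢ (Metric.sphere (0 : ℂ) 1), AnalyticAt ℂ R z ∧ IsUnit (R z))
    (S : WienerHopf.StableData U Xp Xm) (hS : S.Represents R) :
    (WienerHopf.AdmitsLeftCanonicalFactorization R ↔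
      ∃ Q : Xm →L[ℂ] Xp, S.IsStabilizingSolution Q) ∧
    (∀ Q₁ Q₂ : Xm →L[ℂ] Xp,
      S.IsStabilizingSolution Q₁ → S.IsStabilizingSolution Q₂ → Q₁ = Q₂) ∧
    (∀ Q : Xm →L[ℂ] Xp, S.IsStabilizingSolution Q →
      ∀ δp δm : U →L[ℂ] U, IsUnit δp → IsUnit δm → δp ∘L δm = S.pivot Q →
        WienerHopf.IsLeftCanonicalFactorization R (S.Wp Q δp δm) (S.Wm Q δp δm) ∧
        (∀ z : ℂ, ‖z‖ ≤ 1 → Ring.inverse (S.Wp Q δp δm z) = S.WpInv Q δp δm z) ∧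
        (∀ z : ℂ, 1 ≤ ‖z‖ → Ring.inverse (S.Wm Q δp δm z) = S.WmInv Q δp δm z)) := by
  refine ⟨⟨?_, ?_⟩, fun Q₁ Q₂ h₁ h₂ => h₁.unique h₂, fun Q hQ δp δm hp hm h =>
    ⟨WienerHopf.StableData.isLeftCanonicalFactorization hS hQ hp hm h,
      fun z hz => (WienerHopf.StableData.isUnit_Wp_and_inverse hQ hp h hz).2,
      fun z hz => (WienerHopf.StableData.isUnit_Wm_and_inverse hQ hp hm h hz).2⟩⟩
  · rintro ⟨Wp, Wm, hW⟩
    obtain ⟨N, N', hN, hN', hNN', hN'N, hNW⟩ := hW.exterior.exists_coordinate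
    refine S.exists_isStabilizingSolution hW.interior.analytic hW.interior.analytic_inv hN hN'
      (fun z hz => WienerHopf.comp_inverse_self (hW.interior.isUnit z hz))
      (fun z hz => WienerHopf.inverse_comp_self (hW.interior.isUnit z hz)) hNN' hN'N
      fun z w hz hzw => ?_
    have hz' : z ∈ Metric.sphere (0 : ℂ) 1 := by simpa using hz
    rw [hNW z w hzw, ← hW.factor.self_of_nhdsSet z hz', hS.self_of_nhdsSet z hz']
  · rintro ⟨Q, hQ⟩
    exact ⟨_, _, WienerHopf.StableData.isLeftCanonicalFactorization hS hQ hQ.isUnit_pivot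
      isUnit_one (mul_one _)⟩
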